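/- Let $\Omega=(-1,1)$ and let $H^2(\Omega)$ be the second-order Sobolev space of real functions on $\Omega$ (continuously differentiable $u$ with $u'$ absolutely continuous and $u''\in L^2(\Omega)$). Let $0<p<1$, $q=1-p$ and $B>0$. There is a constant $C_l>0$, depending only on $p$ and $B$, such that for every $\delta\in(0,1)$ there is an $n_0$ (depending only on $p,B,\delta$) such that the following holds for all $N>n_0$. Let $f:\mathbb R\to\mathbb R$ be $\nu$-Lipschitz and twice differentiable with $|f''|\le\eta$ for some $\eta>0$. Let $K\ge 1$, let $x_1,\dots,x_K\in\mathbb R$ be the data, let $\alpha_1<\dots<\alpha_K$ be points of $\Omega$ (encoder points), and let $u_{\rm enc}\in H^2(\Omega)$ be the encoder (any element of $H^2(\Omega)$, for instance a smoothing spline fitted to the data $(\alpha_k,x_k)$). Let $\beta_1<\dots<\beta_N$ be points of $\Omega$ (decoder points), put $\beta_0=-1$, $\beta_{N+1}=1$, and assume $\Delta_{\max}/\Delta_{\min}\le B$, where $\Delta_{\max}=\max_{0\le n\le N}(\beta_{n+1}-\beta_n)$ and $\Delta_{\min}=\min_{1\le n\le N-1}(\beta_{n+1}-\beta_n)$. Let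 $0\le\lambda_{\rm dec}\le N^{-4}$. For each nonempty set $\mathcal F\subseteq\{1,\dots,N\}$ of non-straggling servers let the decoder $u_{\rm dec}=u_{\rm dec}^{\mathcal F}$ be a minimizer over $u\in H^2(\Omega)$ of $$\frac1{|\mathcal F|}\sum_{v\in\mathcal F}\bigl(u(\beta_v)-f(u_{\rm enc}(\beta_v))\bigr)^2+\lambda_{\rm dec}\int_\Omega (u''(t))^2\,dt ,$$ where for $\lambda_{\rm dec}=0$ a minimizer of least $\int_\Omega (u'')^2$ is taken (the natural interpolating spline). Suppose that each server is a straggler with probability $p$, independently of the others, and let $\mathcal F$ be the random set of non-stragglers. Then with probability at least $1-\delta$ (over $\mathcal F$) the average approximation error $\mathcal L(\hat f)=\frac1K\sum_{k=1}^K\bigl(u_{\rm dec}(\alpha_k)-f(x_k)\bigr)^2$ satisfies $$\mathcal L(\hat f)\le C_l\,\frac{\bigl(\log_{1/p}(qN)+\sqrt{1/\delta}\bigr)^3}{N^3}\,\bigl\|(f\circ u_{\rm enc})''\bigr\|_{L^2(\Omega)}^2+\frac2K\sum_{k=1}^K\bigl(f(u_{\rm enc}(\alpha_k))-f(x_k)\bigr)^2$$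 and $$\mathcal L(\hat f)\le C_l\,\frac{\bigl(\log_{1/p}(qN)+\sqrt{1/\delta}\bigr)^3}{N^3}\,\bigl\|(f\circ u_{\rm enc})''\bigr\|_{L^2(\Omega)}^2+\frac{2\nu^2}K\sum_{k=1}^K\bigl(u_{\rm enc}(\alpha_k)-x_k\bigr)^2 .$$ -/

import Mathlib

open MeasureTheory ProbabilityTheory

noncomputable section

namespace LeTCC

/-- The open interval `Ω = (-1, 1)` in which all mapping points lie. -/
abbrev domain : Set ℝ := Set.Ioo (-1) 1

/-- `u` belongs to the second-order Sobolev space `H²(Ω)` of scalar functions (taken in its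
pointwise defined, continuously differentiable version): `u` is differentiable on `Ω`, `u'` is
absolutely continuous on every compact subinterval of `Ω`, and `u'' ∈ L²(Ω)`.
On the bounded interval `Ω` this already gives `u, u' ∈ L²(Ω)`. Only the values of `u` on the open
set `Ω` matter. -/
structure MemH2 (u : ℝ → ℝ) : Prop where
  differentiableOn : DifferentiableOn ℝ u domain
  absolutelyContinuous_deriv : ∀ a ∈ domain, ∀ b ∈ domain,
    AbsolutelyContinuousOnInterval (deriv u) a b
  memLp_deriv_deriv : MemLp (deriv (deriv u)) 2 (volume.restrict domain)

/-- `‖u''‖²` in `L²(Ω)`, that is, `∫_Ω (u''(t))² dt`. -/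
def roughness (u : ℝ → ℝ) : ℝ := ∫ t in domain, (deriv (deriv u) t) ^ 2

/-- The penalised least squares functional
`(1/|F|) ∑_{v ∈ F} (u(t_v) - y_v)² + lam ∫_Ω (u'')²`. -/
def splineLoss {N : ℕ} (F : Finset (Fin N)) (t y : Fin N → ℝ) (lam : ℝ) (u : ℝ → ℝ) : ℝ :=
  (1 / (F.card : ℝ)) * ∑ v ∈ F, (u (t v) - y v) ^ 2 + lam * roughness u

/-- `u` is a second-order smoothing spline for the data `(t_v, y_v)`, `v ∈ F`, with smoothing
parameter `lam`: it minimises the penalised least squares functional over `H²(Ω)`.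
For `lam = 0` (the non-smooth version) the minimisers are all the interpolants of the data, and
the smoothing spline is one of least `∫_Ω (u'')²` among them, the natural interpolating spline. -/
structure IsSmoothingSpline {N : ℕ} (F : Finset (Fin N)) (t y : Fin N → ℝ) (lam : ℝ)
    (u : ℝ → ℝ) : Prop where
  memH2 : MemH2 u
  isMin : ∀ w : ℝ → ℝ, MemH2 w → splineLoss F t y lam u ≤ splineLoss F t y lam w
  isMin_roughness : lam = 0 → ∀ w : ℝ → ℝ, MemH2 w →
    splineLoss F t y lam w = splineLoss F t y lam u → roughness u ≤ roughness w

/-- The decoder mapping points together with the end points of `Ω`: with the points numbered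
`β_1, …, β_N`, this is `β_0 = -1`, `β_n` for `1 ≤ n ≤ N`, and `β_{N+1} = 1`. -/
def node {N : ℕ} (β : Fin N → ℝ) : ℕ → ℝ
  | 0 => -1
  | n + 1 => if h : n < N then β ⟨n, h⟩ else 1

/-- `Δ_max = max_{0 ≤ n ≤ N} (β_{n+1} - β_n)`. -/
def gapMax {N : ℕ} (β : Fin N → ℝ) : ℝ :=
  ⨆ n : Fin (N + 1), (node β (n + 1) - node β n)

/-- `Δ_min = min_{1 ≤ n ≤ N-1} (β_{n+1} - β_n)`. -/
def gapMin {N : ℕ} (β : Fin N → ℝ) : ℝ :=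
  ⨅ n : Fin (N - 1), (node β (n + 2) - node β (n + 1))

open Classical in
/-- The set of non-stragglers in the outcome `s`, where `straggler n` is the event that server `n`
is a straggler. -/
def nonStragglers {S : Type*} {N : ℕ} (straggler : Fin N → Set S) (s : S) : Finset (Fin N) :=
  Finset.univ.filter fun n => s ∉ straggler n

/-- The average approximation error `(1/K) ∑_k (u_dec(α_k) - f(x_k))²` of a decoder `udec`. -/
def avgError {K : ℕ} (f : ℝ → ℝ) (α x : Fin K → ℝ) (udec : ℝ → ℝ) : ℝ :=
  (1 / (K : ℝ)) * ∑ k, (udec (α k) - f (x k)) ^ 2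

end LeTCC

end

namespace LeTCC

open Set Filter Topology

/-! Write `h = f ∘ uenc`, which is again in H²(Ω) because `f'` and `f''` are bounded. The decoder
`u` smooths samples of `h`, so testing its minimality against `h` itself gives two facts: `u` is at
most as rough as `h`, and at each surviving point the squared residual is at most `N * lam *
roughness h`, which is at most `N⁻³ * roughness h`.

A union bound shows that, outside an event of probability `N * p ^ m ≤ δ`, no `m` consecutive
servers all straggle; `m` of order `log (N / δ) / log (1 / p)` suffices. Since `Δ_max ≤ 4B/N`, every
interval of length `L = m * Δ_max` well inside Ω then contains a surviving point.

Given `s` in Ω, choose two surviving points on the side of `s` facing the centre, within `3L` of `s`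
and at least `L` apart. Linear extrapolation of `u - h` from them to `s` costs the residuals plus
first-order Taylor remainders, whose squares are `O(L³) * roughness h` (`MemH2.sq_taylor_le`,
`sq_sub_le_of_extrapolation`). Extrapolating inwards treats the ends of Ω like any other place.
Averaging over the `α k` and splitting off `h (α k) - f (x k)` gives the theorem. -/

lemma _root_.AbsolutelyContinuousOnInterval.congr {X : Type*} [PseudoMetricSpace X] {f g : ℝ → X}
    {a b : ℝ} (hf : AbsolutelyContinuousOnInterval f a b) (hfg : EqOn f g (uIcc a b)) :
    AbsolutelyContinuousOnInterval g a b := by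
  rw [absolutelyContinuousOnInterval_iff] at hf ⊢
  intro ε hε
  obtain ⟨δ, hδ, h⟩ := hf ε hε
  refine ⟨δ, hδ, fun E hE hlt => ?_⟩
  refine (Finset.sum_congr rfl fun i hi => ?_).trans_lt (h E hE hlt)
  have := hE.1 i hi
  rw [hfg this.1, hfg this.2]

lemma roughness_nonneg (u : ℝ → ℝ) : 0 ≤ roughness u :=
  integral_nonneg fun _ => sq_nonneg _

lemma uIcc_subset_domain {a b : ℝ} (ha : a ∈ domain) (hb : b ∈ domain) : uIcc a b ⊆ domain :=
  ordConnected_Ioo.uIcc_subset ha hb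

/-- Cauchy–Schwarz against the constant 1, obtained by expanding the integral of the square of `(b -
a) * g - ∫ g`. -/
lemma sq_intervalIntegral_le {g : ℝ → ℝ} {a b : ℝ} (hab : a ≤ b)
    (hg : IntervalIntegrable g volume a b) (hg2 : IntervalIntegrable (fun t => g t ^ 2) volume a b) :
    (∫ t in a..b, g t) ^ 2 ≤ (b - a) * ∫ t in a..b, g t ^ 2 := by
  rcases hab.eq_or_lt with rfl | hlt
  · simp
  set D := ∫ t in a..b, g t with hD
  have h0 : 0 ≤ ∫ t in a..b, ((b - a) * g t - D) ^ 2 :=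
    intervalIntegral.integral_nonneg hab fun _ _ => sq_nonneg _
  have hexp : ∫ t in a..b, ((b - a) * g t - D) ^ 2
      = (b - a) ^ 2 * (∫ t in a..b, g t ^ 2) - 2 * (b - a) * D * D + (b - a) * D ^ 2 := by
    have : (fun t => ((b - a) * g t - D) ^ 2)
        = fun t => (b - a) ^ 2 * g t ^ 2 - 2 * (b - a) * D * g t + D ^ 2 := by
      funext t; ring
    rw [this, intervalIntegral.integral_add ((hg2.const_mul _).sub (hg.const_mul _))
      intervalIntegrable_const, intervalIntegral.integral_sub (hg2.const_mul _) (hg.const_mul _),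
      intervalIntegral.integral_const_mul, intervalIntegral.integral_const_mul,
      intervalIntegral.integral_const, ← hD, smul_eq_mul]
  rw [hexp] at h0
  have hpos : 0 < b - a := sub_pos.2 hlt
  have : 0 ≤ (b - a) * ((b - a) * (∫ t in a..b, g t ^ 2) - D ^ 2) := by
    refine h0.trans_eq ?_
    ring
  linarith [nonneg_of_mul_nonneg_right this hpos]

/-! ### Pointwise estimates in H²(Ω) and stability under composition -/

namespace MemH2

variable {u v : ℝ → ℝ}

lemma integrableOn_sq (hu : MemH2 u) :
    IntegrableOn (fun t => deriv (deriv u) t ^ 2) domain :=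
  hu.memLp_deriv_deriv.integrable_sq

lemma sq_deriv_sub_le (hu : MemH2 u) {a b : ℝ} (ha : a ∈ domain) (hb : b ∈ domain) :
    (deriv u b - deriv u a) ^ 2 ≤ |b - a| * roughness u := by
  wlog hab : a ≤ b generalizing a b
  · rw [abs_sub_comm, ← neg_sub, neg_sq]
    exact this hb ha (le_of_not_ge hab)
  have hac := hu.absolutelyContinuous_deriv a ha b hb
  have hsub : Ioc a b ⊆ domain := fun x hx => ⟨ha.1.trans hx.1, hx.2.trans_lt hb.2⟩
  rw [← hac.integral_deriv_eq_sub, abs_of_nonneg (sub_nonneg.2 hab)]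
  refine (sq_intervalIntegral_le hab hac.intervalIntegrable_deriv ?_).trans ?_
  · rw [intervalIntegrable_iff_integrableOn_Ioc_of_le hab]
    exact hu.integrableOn_sq.mono_set hsub
  · refine mul_le_mul_of_nonneg_left ?_ (sub_nonneg.2 hab)
    rw [intervalIntegral.integral_of_le hab]
    exact setIntegral_mono_set hu.integrableOn_sq (ae_of_all _ fun _ => sq_nonneg _)
      hsub.eventuallyLE

lemma exists_deriv_bound (hu : MemH2 u) : ∃ M : NNReal, ∀ t ∈ domain, |deriv u t| ≤ M := by
  have h0 : (0 : ℝ) ∈ domain := by constructor <;> norm_num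
  have hR := roughness_nonneg u
  -- `roughness u + 1` dominates the square root of `roughness u`, which is what the Hölder bound
  -- from 0 yields.
  refine ⟨⟨|deriv u 0| + (roughness u + 1), by positivity⟩, fun t ht => ?_⟩
  have h := hu.sq_deriv_sub_le h0 ht
  have ht1 : |t - 0| ≤ 1 := by
    rw [sub_zero]
    exact abs_le.2 ⟨ht.1.le, ht.2.le⟩
  have h1 : |deriv u t - deriv u 0| ≤ roughness u + 1 := by
    refine abs_le_of_sq_le_sq ?_ (by positivity)
    nlinarith [mul_le_mul_of_nonneg_right ht1 hR]
  have h2 := abs_sub_abs_le_abs_sub (deriv u t) (deriv u 0)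
  change _ ≤ |deriv u 0| + (roughness u + 1)
  linarith

lemma differentiableAt (hu : MemH2 u) {t : ℝ} (ht : t ∈ domain) : DifferentiableAt ℝ u t :=
  (hu.differentiableOn t ht).differentiableAt (isOpen_Ioo.mem_nhds ht)

/-- A mean value point `ξ` turns the remainder into `(u' ξ - u' t) * (x - t)`, and `u'` is
1/2-Hölder by `sq_deriv_sub_le`. -/
lemma sq_taylor_le (hu : MemH2 u) {t x : ℝ} (ht : t ∈ domain) (hx : x ∈ domain) :
    (u x - u t - deriv u t * (x - t)) ^ 2 ≤ |x - t| ^ 3 * roughness u := by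
  have hR := roughness_nonneg u
  have key : ∃ ξ ∈ domain, |ξ - t| ≤ |x - t| ∧ u x - u t = deriv u ξ * (x - t) := by
    rcases lt_trichotomy t x with h | rfl | h
    · have hs : Icc t x ⊆ domain := ordConnected_Ioo.out ht hx
      obtain ⟨ξ, hξ, he⟩ := exists_deriv_eq_slope u h (hu.differentiableOn.continuousOn.mono hs)
        (hu.differentiableOn.mono (Ioo_subset_Icc_self.trans hs))
      refine ⟨ξ, hs (Ioo_subset_Icc_self hξ), ?_, ?_⟩
      · rw [abs_of_pos (sub_pos.2 hξ.1), abs_of_pos (sub_pos.2 h)]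
        linarith [hξ.2]
      · rw [he, div_mul_cancel₀ _ (sub_pos.2 h).ne']
    · exact ⟨t, ht, le_rfl, by simp⟩
    · have hs : Icc x t ⊆ domain := ordConnected_Ioo.out hx ht
      obtain ⟨ξ, hξ, he⟩ := exists_deriv_eq_slope u h (hu.differentiableOn.continuousOn.mono hs)
        (hu.differentiableOn.mono (Ioo_subset_Icc_self.trans hs))
      refine ⟨ξ, hs (Ioo_subset_Icc_self hξ), ?_, ?_⟩
      · rw [abs_of_neg (sub_neg.2 hξ.2), abs_of_neg (sub_neg.2 h)]
        linarith [hξ.1]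
      · rw [he]
        have := (sub_pos.2 h).ne'
        field_simp
        ring
  obtain ⟨ξ, hξ, hle, he⟩ := key
  calc (u x - u t - deriv u t * (x - t)) ^ 2
      = (deriv u ξ - deriv u t) ^ 2 * |x - t| ^ 2 := by rw [he, sq_abs]; ring
    _ ≤ (|x - t| * roughness u) * |x - t| ^ 2 := by
        refine mul_le_mul_of_nonneg_right ((hu.sq_deriv_sub_le ht hξ).trans ?_) (by positivity)
        exact mul_le_mul_of_nonneg_right hle hR
    _ = _ := by ring

lemma lipschitzOnWith (hu : MemH2 u) : ∃ M : NNReal, LipschitzOnWith M u domain := by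
  obtain ⟨M, hM⟩ := hu.exists_deriv_bound
  exact ⟨M, (convex_Ioo (-1 : ℝ) 1).lipschitzOnWith_of_nnnorm_deriv_le
    (fun x hx => hu.differentiableAt hx) fun x hx => hM x hx⟩

lemma ae_differentiableAt_deriv (hu : MemH2 u) :
    ∀ᵐ t, t ∈ domain → DifferentiableAt ℝ (deriv u) t := by
  refine ae_of_mem_of_ae_of_mem_inter_Ioo fun a b ha hb hab => ?_
  filter_upwards [(hu.absolutelyContinuous_deriv a ha b hb).ae_differentiableAt] with t h ht
  exact h (Icc_subset_uIcc (Ioo_subset_Icc_self ht.2))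

/-- `H²(Ω)` is preserved by composition with functions having bounded first and second
derivative. -/
lemma comp (hu : MemH2 u) {f : ℝ → ℝ} {ν : NNReal} {η : ℝ} (hf : LipschitzWith ν f)
    (hfd : Differentiable ℝ f) (hfdd : Differentiable ℝ (deriv f))
    (hη : ∀ z, |deriv (deriv f) z| ≤ η) : MemH2 (f ∘ u) := by
  have hη0 : 0 ≤ η := (abs_nonneg _).trans (hη 0)
  have hd : EqOn (deriv (f ∘ u)) ((deriv f ∘ u) * deriv u) domain := fun t ht => by
    simp [deriv_comp t (hfd _) (hu.differentiableAt ht)]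
  refine ⟨hfd.comp_differentiableOn hu.differentiableOn, fun a ha b hb => ?_, ?_⟩
  · have hf' : LipschitzWith ⟨η, hη0⟩ (deriv f) :=
      lipschitzWith_of_nnnorm_deriv_le hfdd fun z => hη z
    obtain ⟨M, hM⟩ := hu.lipschitzOnWith
    have hc : AbsolutelyContinuousOnInterval (deriv f ∘ u) a b :=
      ((hf'.comp_lipschitzOnWith hM).mono
        (uIcc_subset_domain ha hb)).absolutelyContinuousOnInterval
    exact (hc.mul (hu.absolutelyContinuous_deriv a ha b hb)).congr
      fun t ht => (hd (uIcc_subset_domain ha hb ht)).symm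
  · obtain ⟨M, hM⟩ := hu.exists_deriv_bound
    have hconst : MemLp (fun _ : ℝ => η * (M : ℝ) ^ 2) 2 (volume.restrict (Ioo (-1 : ℝ) 1)) :=
      memLp_const _
    have hg : MemLp (fun t => η * M ^ 2 + ν * |deriv (deriv u) t|) 2 (volume.restrict domain) :=
      hconst.add (hu.memLp_deriv_deriv.norm.const_mul (ν : ℝ))
    refine hg.mono (measurable_deriv _).aestronglyMeasurable ?_
    refine (ae_restrict_iff' measurableSet_Ioo).2 ?_
    filter_upwards [hu.ae_differentiableAt_deriv] with t h ht
    -- The second-order chain rule is available only where `u'` is differentiable, hence almost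
    -- everywhere; this suffices for the L² domination by `η * M ^ 2 + ν * |u''|`.
    have h2 : HasDerivAt (deriv (f ∘ u))
        (deriv (deriv f) (u t) * deriv u t * deriv u t + deriv f (u t) * deriv (deriv u) t) t := by
      refine HasDerivAt.congr_of_eventuallyEq (f := fun s => deriv f (u s) * deriv u s) ?_
        (hd.eventuallyEq_of_mem (isOpen_Ioo.mem_nhds ht))
      exact ((hfdd _).hasDerivAt.comp t (hu.differentiableAt ht).hasDerivAt).mul
        (h ht).hasDerivAt
    have hν : |deriv f (u t)| ≤ ν := norm_deriv_le_of_lipschitz hf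
    rw [h2.deriv, Real.norm_eq_abs, Real.norm_eq_abs]
    refine le_trans ?_ (le_abs_self _)
    refine (abs_add_le _ _).trans (add_le_add ?_ ?_)
    · rw [mul_assoc, abs_mul, abs_mul, ← sq]
      exact mul_le_mul (hη _) (pow_le_pow_left₀ (abs_nonneg _) (hM t ht) 2) (by positivity) hη0
    · rw [abs_mul]
      exact mul_le_mul_of_nonneg_right hν (abs_nonneg _)

end MemH2

/-! ### Consequences of minimality -/

namespace IsSmoothingSpline

variable {N : ℕ} {F : Finset (Fin N)} {t : Fin N → ℝ} {lam : ℝ} {u h : ℝ → ℝ}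

lemma splineLoss_self : splineLoss F t (fun n => h (t n)) lam h = lam * roughness h := by
  simp [splineLoss]

lemma mean_sq_nonneg (y : Fin N → ℝ) : 0 ≤ (1 / (F.card : ℝ)) * ∑ v ∈ F, (u (t v) - y v) ^ 2 :=
  mul_nonneg (by positivity) (Finset.sum_nonneg fun _ _ => sq_nonneg _)

/-- The smoothing spline of samples of `h ∈ H²(Ω)` is at most as rough as `h`. -/
lemma roughness_le (hs : IsSmoothingSpline F t (fun n => h (t n)) lam u) (hh : MemH2 h)
    (hlam : 0 ≤ lam) : roughness u ≤ roughness h := by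
  have hmin := hs.isMin h hh
  rw [splineLoss_self] at hmin
  have hnn := mean_sq_nonneg (F := F) (t := t) (u := u) (fun n => h (t n))
  rcases hlam.eq_or_lt with h0 | h0
  -- For `lam = 0` the function `h` has zero loss, so it ties with `u` and the least-roughness
  -- clause applies.
  · refine hs.isMin_roughness h0.symm h hh (le_antisymm ?_ (hs.isMin h hh))
    rw [splineLoss_self, splineLoss, ← h0, zero_mul, zero_mul, add_zero]
    exact hnn
  · unfold splineLoss at hmin
    exact le_of_mul_le_mul_left (by linarith) h0

/-- The residuals of the smoothing spline of samples of `h ∈ H²(Ω)`. -/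
lemma sq_residual_le (hs : IsSmoothingSpline F t (fun n => h (t n)) lam u) (hh : MemH2 h)
    (hlam : 0 ≤ lam) {v : Fin N} (hv : v ∈ F) :
    (u (t v) - h (t v)) ^ 2 ≤ N * lam * roughness h := by
  have hmin := hs.isMin h hh
  rw [splineLoss_self] at hmin
  unfold splineLoss at hmin
  have hc : (0 : ℝ) < F.card := by exact_mod_cast Finset.card_pos.2 ⟨v, hv⟩
  have hcN : (F.card : ℝ) ≤ N := by
    exact_mod_cast (Finset.card_le_univ F).trans_eq (Fintype.card_fin N)
  have h1 : (1 / (F.card : ℝ)) * ∑ w ∈ F, (u (t w) - h (t w)) ^ 2 ≤ lam * roughness h := by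
    linarith [mul_nonneg hlam (roughness_nonneg u)]
  rw [one_div, inv_mul_le_iff₀ hc] at h1
  calc (u (t v) - h (t v)) ^ 2 ≤ ∑ w ∈ F, (u (t w) - h (t w)) ^ 2 :=
        Finset.single_le_sum (f := fun w => (u (t w) - h (t w)) ^ 2) (fun _ _ => sq_nonneg _) hv
    _ ≤ F.card * (lam * roughness h) := h1
    _ ≤ N * (lam * roughness h) :=
        mul_le_mul_of_nonneg_right hcN (mul_nonneg hlam (roughness_nonneg h))
    _ = _ := by ring

end IsSmoothingSpline

/-- Error of linear extrapolation from two points `a`, `b` on the same side of `s`. -/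
lemma sq_sub_le_of_extrapolation {u h : ℝ → ℝ} (hu : MemH2 u) (hh : MemH2 h)
    (hR : roughness u ≤ roughness h) {s a b L E : ℝ} (hs : s ∈ domain) (ha : a ∈ domain)
    (hb : b ∈ domain) (hL : 0 < L) (has : |a - s| ≤ L) (hbs : |b - s| ≤ 3 * L)
    (hab : L ≤ |b - a|) (hEa : (u a - h a) ^ 2 ≤ E) (hEb : (u b - h b) ^ 2 ≤ E) :
    (u s - h s) ^ 2 ≤ 40 * E + 576 * L ^ 3 * roughness h := by
  have hRh := roughness_nonneg h
  have rem : ∀ x ∈ domain, ∀ c : ℝ, |x - s| ≤ c →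
      ((u x - u s - deriv u s * (x - s)) - (h x - h s - deriv h s * (x - s))) ^ 2
        ≤ 4 * c ^ 3 * roughness h := by
    intro x hx c hc
    have h1 := hu.sq_taylor_le hs hx
    have h2 := hh.sq_taylor_le hs hx
    have hc3 : |x - s| ^ 3 ≤ c ^ 3 := pow_le_pow_left₀ (abs_nonneg _) hc 3
    have h3 : |x - s| ^ 3 * roughness u ≤ c ^ 3 * roughness h :=
      mul_le_mul hc3 hR (roughness_nonneg u) ((by positivity : (0 : ℝ) ≤ |x - s| ^ 3).trans hc3)
    have h4 : |x - s| ^ 3 * roughness h ≤ c ^ 3 * roughness h :=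
      mul_le_mul_of_nonneg_right hc3 hRh
    nlinarith [sq_nonneg ((u x - u s - deriv u s * (x - s)) + (h x - h s - deriv h s * (x - s)))]
  have hra := rem a ha L has
  have hrb := rem b hb (3 * L) hbs
  obtain ⟨ra, hra_def⟩ :
      ∃ r, r = (u a - u s - deriv u s * (a - s)) - (h a - h s - deriv h s * (a - s)) := ⟨_, rfl⟩
  obtain ⟨rb, hrb_def⟩ :
      ∃ r, r = (u b - u s - deriv u s * (b - s)) - (h b - h s - deriv h s * (b - s)) := ⟨_, rfl⟩
  rw [← hra_def] at hra
  rw [← hrb_def] at hrb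
  have hD : b - a ≠ 0 := abs_pos.1 (hL.trans_le hab)
  have hX : ((b - s) / (b - a)) ^ 2 ≤ 9 := by
    have : |(b - s) / (b - a)| ≤ 3 := by
      rw [abs_div, div_le_iff₀ (hL.trans_le hab)]
      linarith
    rw [← sq_abs]
    nlinarith [abs_nonneg ((b - s) / (b - a))]
  have hY : ((a - s) / (b - a)) ^ 2 ≤ 1 := by
    have : |(a - s) / (b - a)| ≤ 1 := by
      rw [abs_div, div_le_iff₀ (hL.trans_le hab)]
      linarith
    rw [← sq_abs]
    nlinarith [abs_nonneg ((a - s) / (b - a))]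
  -- The two weights sum to 1 and annihilate the slope of `u - h` at `s`, leaving only residuals and
  -- Taylor remainders.
  have he : u s - h s = (b - s) / (b - a) * (u a - h a) - (a - s) / (b - a) * (u b - h b)
      - (b - s) / (b - a) * ra + (a - s) / (b - a) * rb := by
    rw [hra_def, hrb_def]
    field_simp
    ring
  have h4 : ∀ x y z w : ℝ, (x - y - z + w) ^ 2 ≤ 4 * (x ^ 2 + y ^ 2 + z ^ 2 + w ^ 2) :=
    fun x y z w => by
      nlinarith [sq_nonneg (x + y), sq_nonneg (x + z), sq_nonneg (x - w), sq_nonneg (y - z),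
        sq_nonneg (y + w), sq_nonneg (z + w)]
  rw [he]
  refine (h4 _ _ _ _).trans ?_
  rw [mul_pow, mul_pow, mul_pow, mul_pow]
  have m1 := mul_le_mul hX hEa (sq_nonneg _) (by norm_num)
  have m2 := mul_le_mul hY hEb (sq_nonneg _) (by norm_num)
  have m3 := mul_le_mul hX hra (sq_nonneg _) (by norm_num)
  have m4 := mul_le_mul hY hrb (sq_nonneg _) (by norm_num)
  -- With squared weights at most 9 and 1: `40 = 4 * (9 + 1)` and `576 = 4 * (9 * 4 + 4 * 27)`, the
  -- 27 coming from `(3L)³`.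
  linarith

/-! ### Spacing of the decoder points and the deterministic error bound -/

section Nodes

variable {N : ℕ} {β : Fin N → ℝ}

lemma node_succ (β : Fin N → ℝ) (n : Fin N) : node β (n + 1) = β n := by
  simp [node, n.2]

lemma node_eq_one (β : Fin N → ℝ) {n : ℕ} (hn : N < n) : node β n = 1 := by
  obtain ⟨m, rfl⟩ := Nat.exists_eq_succ_of_ne_zero (by omega : n ≠ 0)
  exact dif_neg (by omega)

lemma node_sub_le_gapMax {n : ℕ} (hn : n ≤ N) : node β (n + 1) - node β n ≤ gapMax β :=
  le_ciSup (f := fun k : Fin (N + 1) => node β (k + 1) - node β k)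
    (Set.finite_range _).bddAbove ⟨n, by omega⟩

lemma gapMin_le_node_sub {n : ℕ} (hn : n + 1 < N) : gapMin β ≤ node β (n + 2) - node β (n + 1) :=
  ciInf_le (f := fun k : Fin (N - 1) => node β (k + 2) - node β (k + 1))
    (Set.finite_range _).bddBelow ⟨n, by omega⟩

lemma gapMax_pos (hN : 0 < N) (hβ : ∀ n, β n ∈ domain) : 0 < gapMax β := by
  have h := node_sub_le_gapMax (β := β) (n := 0) (by omega)
  have h1 := node_succ β ⟨0, hN⟩
  have h2 := (hβ ⟨0, hN⟩).1
  simp only [zero_add] at h h1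
  rw [h1] at h
  simp only [node] at h
  linarith

lemma gapMin_pos (hN : 2 ≤ N) (hmono : StrictMono β) : 0 < gapMin β := by
  have : Nonempty (Fin (N - 1)) := ⟨⟨0, by omega⟩⟩
  obtain ⟨k, hk⟩ := exists_eq_ciInf_of_finite
    (f := fun k : Fin (N - 1) => node β (k + 2) - node β (k + 1))
  rw [gapMin, ← hk]
  have h1 := node_succ β ⟨k, by omega⟩
  have h2 := node_succ β ⟨k + 1, by omega⟩
  simp only [add_assoc, one_add_one_eq_two] at h1 h2
  rw [h1, h2, sub_pos]
  exact hmono (by simp)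

lemma mul_gapMin_le (hN : 2 ≤ N) (hβ : ∀ n, β n ∈ domain) : (N - 1 : ℝ) * gapMin β ≤ 2 := by
  have h : ∀ n : ℕ, n < N → n * gapMin β ≤ node β (n + 1) - node β 1 := by
    intro n
    induction n with
    | zero => intro _; simp
    | succ n ih =>
      intro hn
      have h1 := ih (by omega)
      have h2 := gapMin_le_node_sub (β := β) hn
      push_cast
      linarith
  have h0 := h (N - 1) (by omega)
  have h1 := node_succ β ⟨0, by omega⟩
  have h2 := node_succ β ⟨N - 1, by omega⟩
  have h3 := (hβ ⟨0, by omega⟩).1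
  have h4 := (hβ ⟨N - 1, by omega⟩).2
  simp only [zero_add] at h1 h2
  rw [h1, h2, Nat.cast_sub (by omega), Nat.cast_one] at h0
  linarith

lemma gapMax_le {B : ℝ} (hB : 0 < B) (hN : 2 ≤ N) (hmono : StrictMono β)
    (hβ : ∀ n, β n ∈ domain) (h : gapMax β / gapMin β ≤ B) : gapMax β ≤ 4 * B / N := by
  have hN' : (2 : ℝ) ≤ N := by exact_mod_cast hN
  -- The `N - 1` inner gaps fit into length 2 and `N - 1 ≥ N / 2`, whence `N * gapMin β ≤ 4`.
  rw [div_le_iff₀ (gapMin_pos hN hmono)] at h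
  rw [le_div_iff₀ (by linarith)]
  have h1 := mul_gapMin_le hN hβ
  have h2 := gapMin_pos hN hmono
  have h3 : (N : ℝ) * gapMin β ≤ 4 := by nlinarith
  nlinarith

lemma node_add_le (hN : 0 < N) (hβ : ∀ n, β n ∈ domain) (i j : ℕ) :
    node β (i + j) ≤ node β i + j * gapMax β := by
  induction j with
  | zero => simp
  | succ j ih =>
    have hg := gapMax_pos hN hβ
    rw [← add_assoc]
    push_cast
    rcases le_or_gt (i + j) N with h | h
    · linarith [node_sub_le_gapMax (β := β) h]
    · rw [node_eq_one β h] at ih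
      rw [node_eq_one β (by omega)]
      linarith

/-- If every `m` consecutive servers contain an element of `F`, every interval of length
`m Δ_max` contains an element of `F`. -/
lemma exists_mem_Icc_of_windows (hN : 0 < N) (hmono : StrictMono β) (hβ : ∀ n, β n ∈ domain)
    {F : Finset (Fin N)} {m : ℕ} (hm : 0 < m)
    (hF : ∀ i : ℕ, i + m ≤ N → ∃ v ∈ F, i ≤ (v : ℕ) ∧ (v : ℕ) < i + m) {s : ℝ}
    (hs : -1 ≤ s) (hs1 : s + m * gapMax β < 1) :
    ∃ v ∈ F, s ≤ β v ∧ β v ≤ s + m * gapMax β := by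
  have hg := gapMax_pos hN hβ
  have hex : ∃ i, s ≤ node β (i + 1) := ⟨N, by
    rw [node_eq_one β (by omega)]
    nlinarith [(Nat.cast_nonneg m : (0 : ℝ) ≤ m)]⟩
  classical
  -- Node `i` is at or left of `s` and node `i + 1` is not left of it. Server `v` sits at node `v +
  -- 1`, so the window `i ≤ v < i + m` occupies nodes `i + 1` to `i + m`, all within `m` gaps of
  -- node `i`.
  set i := Nat.find hex with hi
  have hi1 : s ≤ node β (i + 1) := Nat.find_spec hex
  have hi0 : node β i ≤ s := by
    rcases Nat.eq_zero_or_pos i with h | h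
    · rw [h]
      simpa [node] using hs
    · have := Nat.find_min hex (show i - 1 < Nat.find hex by omega)
      rw [Nat.sub_add_cancel h] at this
      exact (not_le.1 this).le
  have hle : ∀ j ≤ m, node β (i + j) ≤ s + m * gapMax β := fun j hj => by
    have h1 := node_add_le hN hβ i j
    have h2 : (j : ℝ) * gapMax β ≤ m * gapMax β :=
      mul_le_mul_of_nonneg_right (by exact_mod_cast hj) hg.le
    linarith
  have him : i + m ≤ N := by
    by_contra hcon
    have h1 := hle m le_rfl
    rw [node_eq_one β (by omega)] at h1
    linarith
  obtain ⟨v, hv, hv1, hv2⟩ := hF i him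
  refine ⟨v, hv, hi1.trans ?_, ?_⟩
  · have h1 := node_succ β ⟨i, by omega⟩
    simp only at h1
    rw [h1]
    exact hmono.monotone hv1
  · rw [← node_succ β v]
    have := hle (v + 1 - i) (by omega)
    rwa [show i + (v + 1 - i) = v + 1 by omega] at this

/-- Error bound for the smoothing spline when every `m` consecutive servers contain an element
of `F`. -/
lemma IsSmoothingSpline.sq_sub_le_of_windows (hN : 0 < N) (hmono : StrictMono β)
    (hβ : ∀ n, β n ∈ domain) {F : Finset (Fin N)} {m : ℕ} (hm : 0 < m)
    (hF : ∀ i : ℕ, i + m ≤ N → ∃ v ∈ F, i ≤ (v : ℕ) ∧ (v : ℕ) < i + m)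
    (hsmall : 3 * (m * gapMax β) < 1) {lam : ℝ} (hlam : 0 ≤ lam) {u h : ℝ → ℝ}
    (hs : IsSmoothingSpline F β (fun n => h (β n)) lam u) (hh : MemH2 h) {s : ℝ}
    (hsd : s ∈ domain) :
    (u s - h s) ^ 2 ≤ 40 * (N * lam * roughness h) + 576 * (m * gapMax β) ^ 3 * roughness h := by
  have hg := gapMax_pos hN hβ
  have hm' : (0 : ℝ) < m := by exact_mod_cast hm
  have hL : 0 < m * gapMax β := mul_pos hm' hg
  obtain ⟨hs1, hs2⟩ := hsd
  have hnear := fun x => exists_mem_Icc_of_windows (s := x) hN hmono hβ hm hF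
  generalize m * gapMax β = L at *
  -- The points come from the first and third of three adjacent intervals of length `L` running from
  -- `s` towards the centre; `3 * L < 1` keeps these inside Ω, and the skipped one separates the
  -- points.
  have hpair : ∃ v ∈ F, ∃ w ∈ F, |β v - s| ≤ L ∧ |β w - s| ≤ 3 * L ∧ L ≤ |β w - β v| := by
    rcases le_total s 0 with h0 | h0
    · obtain ⟨v, hv, hv1, hv2⟩ := hnear s (by linarith) (by linarith)
      obtain ⟨w, hw, hw1, hw2⟩ := hnear (s + 2 * L) (by linarith) (by linarith)
      refine ⟨v, hv, w, hw, abs_le.2 ⟨?_, ?_⟩, abs_le.2 ⟨?_, ?_⟩, le_abs.2 (Or.inl ?_)⟩ <;>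
        linarith
    · obtain ⟨v, hv, hv1, hv2⟩ := hnear (s - L) (by linarith) (by linarith)
      obtain ⟨w, hw, hw1, hw2⟩ := hnear (s - 3 * L) (by linarith) (by linarith)
      refine ⟨v, hv, w, hw, abs_le.2 ⟨?_, ?_⟩, abs_le.2 ⟨?_, ?_⟩, le_abs.2 (Or.inr ?_)⟩ <;>
        linarith
  obtain ⟨v, hv, w, hw, h1, h2, h3⟩ := hpair
  exact sq_sub_le_of_extrapolation hs.memH2 hh (hs.roughness_le hh hlam) ⟨hs1, hs2⟩ (hβ v) (hβ w)
    hL h1 h2 h3 (hs.sq_residual_le hh hlam hv) (hs.sq_residual_le hh hlam hw)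

end Nodes

/-! ### Runs of stragglers and the choice of window length -/

/-- With probability at least `1 - N p ^ m` every `m` consecutive servers contain a
non-straggler. -/
lemma measure_windows_ge {S : Type*} [MeasurableSpace S] {P : Measure S} [IsProbabilityMeasure P]
    {N : ℕ} {straggler : Fin N → Set S} (hmeas : ∀ n, MeasurableSet (straggler n))
    (hind : iIndepSet straggler P) {p : ℝ} (hp : 0 ≤ p)
    (hP : ∀ n, P (straggler n) = ENNReal.ofReal p) {m : ℕ} (hm : 0 < m) :
    ENNReal.ofReal (1 - N * p ^ m) ≤ P {s | ∀ i : ℕ, i + m ≤ N →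
      ∃ v ∈ nonStragglers straggler s, i ≤ (v : ℕ) ∧ (v : ℕ) < i + m} := by
  classical
  set W : Fin N → Finset (Fin N) := fun i =>
    Finset.univ.filter fun v => (i : ℕ) ≤ v ∧ (v : ℕ) < i + m with hW
  set I : Finset (Fin N) := Finset.univ.filter fun i => (i : ℕ) + m ≤ N with hI
  set bad : Set S := ⋃ i ∈ I, ⋂ v ∈ W i, straggler v with hbad
  have hcard : ∀ i ∈ I, (W i).card = m := by
    intro i hi
    have hi' : (i : ℕ) + m ≤ N := by simpa [hI] using hi
    have : (W i).map Fin.valEmbedding = Finset.Ico (i : ℕ) (i + m) := by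
      ext k
      simp only [hW, Finset.mem_map, Finset.mem_filter, Finset.mem_univ, true_and,
        Fin.valEmbedding_apply, Finset.mem_Ico]
      constructor
      · rintro ⟨v, hv, rfl⟩
        exact hv
      · exact fun hk => ⟨⟨k, by omega⟩, hk, rfl⟩
    rw [← Finset.card_map, this, Nat.card_Ico]
    omega
  have hbadm : MeasurableSet bad :=
    I.measurableSet_biUnion fun i _ => (W i).measurableSet_biInter fun v _ => hmeas v
  -- Union bound over at most `N` windows, each entirely straggling with probability `p ^ m` by
  -- independence.
  have hbadP : P bad ≤ ENNReal.ofReal (N * p ^ m) := by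
    calc P bad ≤ ∑ i ∈ I, P (⋂ v ∈ W i, straggler v) := measure_biUnion_finset_le _ _
      _ = ∑ i ∈ I, ENNReal.ofReal (p ^ m) := Finset.sum_congr rfl fun i hi => by
          rw [hind.meas_biInter, Finset.prod_congr rfl fun v _ => hP v, Finset.prod_const,
            hcard i hi, ENNReal.ofReal_pow hp]
      _ = ENNReal.ofReal (I.card * p ^ m) := by
          rw [Finset.sum_const, nsmul_eq_mul, ENNReal.ofReal_mul (Nat.cast_nonneg _),
            ENNReal.ofReal_natCast]
      _ ≤ ENNReal.ofReal (N * p ^ m) := by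
          refine ENNReal.ofReal_le_ofReal (mul_le_mul_of_nonneg_right ?_ (by positivity))
          exact_mod_cast (Finset.card_le_univ I).trans_eq (Fintype.card_fin N)
  have hsub : badᶜ ⊆ {s | ∀ i : ℕ, i + m ≤ N →
      ∃ v ∈ nonStragglers straggler s, i ≤ (v : ℕ) ∧ (v : ℕ) < i + m} := by
    intro s hs i hi
    by_contra hcon
    refine hs ?_
    simp only [hbad, mem_iUnion, mem_iInter]
    refine ⟨⟨i, by omega⟩, by simpa [hI] using hi, fun v hv => ?_⟩
    by_contra hvs
    exact hcon ⟨v, by simpa [nonStragglers] using hvs, (Finset.mem_filter.1 hv).2⟩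
  refine le_trans ?_ (measure_mono hsub)
  rw [measure_compl hbadm (measure_ne_top _ _), measure_univ, ENNReal.ofReal_sub _ (by positivity),
    ENNReal.ofReal_one]
  exact tsub_le_tsub_left hbadP 1

/-- A window length `m` of order `log_{1/p} (q N) + √(1/δ)` with `N p ^ m ≤ δ`. -/
lemma exists_window_length {p q : ℝ} (hp : 0 < p) (hp1 : p < 1) (hq : 0 < q) (hq1 : q < 1)
    {δ : ℝ} (hδ : 0 < δ) (hδ1 : δ < 1) {N : ℕ} (hN : 2 ≤ N) (hqN : 1 ≤ q * N) :
    ∃ m : ℕ, 0 < m ∧ N * p ^ m ≤ δ ∧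
      (m : ℝ) ≤ (2 + (Real.log (1 / q) + 2) / Real.log (1 / p)) *
        (Real.logb (1 / p) (q * N) + Real.sqrt (1 / δ)) := by
  have hN0 : (1 : ℝ) < N := by exact_mod_cast hN
  have hl : 0 < Real.log (1 / p) := Real.log_pos (by rw [lt_div_iff₀ hp]; linarith)
  have hlq : 0 < Real.log (1 / q) := Real.log_pos (by rw [lt_div_iff₀ hq]; linarith)
  have hlN : 0 ≤ Real.log (q * N) := Real.log_nonneg hqN
  have hNδ : 1 < N / δ := by rw [lt_div_iff₀ hδ]; linarith
  have hlNδ : 0 < Real.log (N / δ) := Real.log_pos hNδ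
  have hs1 : 1 ≤ Real.sqrt (1 / δ) := by
    rw [Real.one_le_sqrt, le_div_iff₀ hδ]
    linarith
  -- This is where `√(1/δ)` enters: `log y ≤ y - 1` at `y = √(1/δ)`.
  have hsl : Real.log (1 / δ) ≤ 2 * Real.sqrt (1 / δ) := by
    have h1 := Real.log_sqrt (x := 1 / δ) (by positivity)
    have h2 := Real.log_le_sub_one_of_pos (x := Real.sqrt (1 / δ)) (by linarith)
    linarith
  refine ⟨⌈Real.log (N / δ) / Real.log (1 / p)⌉₊, Nat.ceil_pos.2 (by positivity), ?_, ?_⟩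
  · have hle := Nat.le_ceil (Real.log (N / δ) / Real.log (1 / p))
    generalize ⌈Real.log (N / δ) / Real.log (1 / p)⌉₊ = m at hle
    rw [div_le_iff₀ hl] at hle
    have h1 : (N : ℝ) / δ ≤ (1 / p) ^ m := by
      rw [← Real.log_le_log_iff (by linarith) (by positivity), Real.log_pow]
      exact hle
    rw [one_div, inv_pow, div_le_iff₀ hδ, inv_mul_eq_div, le_div_iff₀ (by positivity)] at h1
    exact h1
  · have hlt := Nat.ceil_lt_add_one (a := Real.log (N / δ) / Real.log (1 / p)) (by positivity)
    refine hlt.le.trans ?_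
    have hsplit : Real.log (N / δ)
        = Real.log (q * N) + Real.log (1 / q) + Real.log (1 / δ) := by
      rw [← Real.log_mul (by positivity) (by positivity),
        ← Real.log_mul (by positivity) (by positivity)]
      congr 1
      field_simp
    rw [Real.logb, hsplit]
    generalize Real.sqrt (1 / δ) = s at *
    generalize Real.log (q * N) = x at *
    generalize Real.log (1 / q) = y at *
    generalize Real.log (1 / p) = l at *
    generalize Real.log (1 / δ) = z at *
    -- As `s ≥ 1`, the constant `y = log (1 / q)`, and later the 1 lost to the ceiling, are absorbed
    -- into multiples of `s`.
    have h1 : (x + y + z) / l ≤ x / l + (y + 2) / l * s := by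
      rw [div_mul_eq_mul_div, ← add_div, div_le_div_iff_of_pos_right hl]
      nlinarith
    have h2 : 0 ≤ (y + 2) / l * (x / l) := by positivity
    have h3 : 0 ≤ x / l := by positivity
    nlinarith

lemma tendsto_logb_add_const_div (b q c : ℝ) (hq : 0 < q) :
    Tendsto (fun N : ℕ => (Real.logb b (q * N) + c) / N) atTop (𝓝 0) := by
  have h1 : Tendsto (fun N : ℕ => Real.log N / N) atTop (𝓝 0) :=
    (Real.isLittleO_log_id_atTop.tendsto_div_nhds_zero).comp tendsto_natCast_atTop_atTop
  have h2 := (h1.div_const (Real.log b)).add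
    (tendsto_const_div_atTop_nhds_zero_nat (Real.log q / Real.log b + c))
  rw [zero_div, add_zero] at h2
  refine h2.congr' ?_
  filter_upwards [eventually_gt_atTop 0] with N hN
  have : (0 : ℝ) < N := by exact_mod_cast hN
  rw [Real.logb, Real.log_mul hq.ne' this.ne']
  ring

lemma avgError_le {K : ℕ} (hK : 0 < K) {f h u : ℝ → ℝ} {α x : Fin K → ℝ} {E : ℝ}
    (hE : ∀ k, (u (α k) - h (α k)) ^ 2 ≤ E) :
    avgError f α x u ≤ 2 * E + 2 / (K : ℝ) * ∑ k, (h (α k) - f (x k)) ^ 2 := by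
  have hK' : (0 : ℝ) < K := by exact_mod_cast hK
  have hsum : ∑ k, (u (α k) - f (x k)) ^ 2
      ≤ ∑ k, (2 * E + 2 * (h (α k) - f (x k)) ^ 2) :=
    Finset.sum_le_sum fun k _ => by
      nlinarith [hE k, sq_nonneg ((u (α k) - h (α k)) - (h (α k) - f (x k)))]
  rw [Finset.sum_add_distrib, Finset.sum_const, Finset.card_univ, Fintype.card_fin, nsmul_eq_mul,
    ← Finset.mul_sum] at hsum
  calc avgError f α x u ≤ 1 / (K : ℝ) * (K * (2 * E) + 2 * ∑ k, (h (α k) - f (x k)) ^ 2) :=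
        mul_le_mul_of_nonneg_left hsum (by positivity)
    _ = _ := by field_simp

lemma sum_sq_lipschitz_le {K : ℕ} {f : ℝ → ℝ} {ν : NNReal} (hf : LipschitzWith ν f)
    (y x : Fin K → ℝ) :
    2 / (K : ℝ) * ∑ k, (f (y k) - f (x k)) ^ 2
      ≤ 2 * (ν : ℝ) ^ 2 / (K : ℝ) * ∑ k, (y k - x k) ^ 2 := by
  rw [mul_div_right_comm, mul_assoc]
  refine mul_le_mul_of_nonneg_left ?_ (by positivity)
  rw [Finset.mul_sum]
  refine Finset.sum_le_sum fun k _ => ?_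
  have h := hf.dist_le_mul (y k) (x k)
  rw [Real.dist_eq, Real.dist_eq] at h
  rw [← sq_abs, ← sq_abs (y k - x k), ← mul_pow]
  exact pow_le_pow_left₀ (abs_nonneg _) h 2

end LeTCC

/-! ### Choice of constants and conclusion -/

theorem theorem1 (p q B : ℝ) (hpq : p = 1 - q) (hp : 0 < p) (hq : 0 < q) (hB : 0 < B) :
    ∃ C : ℝ, 0 < C ∧ ∀ δ : ℝ, 0 < δ → δ < 1 → ∃ n₀ : ℕ, ∀ N : ℕ, n₀ < N →
      -- the computing function
      ∀ (f : ℝ → ℝ) (ν : NNReal) (η : ℝ), LipschitzWith ν f →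
        Differentiable ℝ f → Differentiable ℝ (deriv f) → 0 < η →
        (∀ z, |deriv (deriv f) z| ≤ η) →
      -- the data, the encoder mapping points, and the encoder
      ∀ (K : ℕ) (x α : Fin K → ℝ), 0 < K → StrictMono α → (∀ k, α k ∈ LeTCC.domain) →
      ∀ uenc : ℝ → ℝ, LeTCC.MemH2 uenc →
      -- the decoder mapping points
      ∀ β : Fin N → ℝ, StrictMono β → (∀ n, β n ∈ LeTCC.domain) →
        LeTCC.gapMax β / LeTCC.gapMin β ≤ B →
      -- the decoder, for every nonempty set of non-stragglers
      ∀ lam : ℝ, 0 ≤ lam → lam ≤ 1 / (N : ℝ) ^ 4 →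
      ∀ udec : Finset (Fin N) → ℝ → ℝ,
        (∀ F : Finset (Fin N), F.Nonempty →
          LeTCC.IsSmoothingSpline F β (fun n => f (uenc (β n))) lam (udec F)) →
      -- the random stragglers
      ∀ (S : Type*) [MeasurableSpace S] (P : Measure S) [IsProbabilityMeasure P]
        (straggler : Fin N → Set S), (∀ n, MeasurableSet (straggler n)) →
        iIndepSet straggler P → (∀ n, P (straggler n) = ENNReal.ofReal p) →
      ENNReal.ofReal (1 - δ) ≤ P {s |
        LeTCC.avgError f α x (udec (LeTCC.nonStragglers straggler s)) ≤
            C * ((Real.logb (1 / p) (q * N) + Real.sqrt (1 / δ)) ^ 3 / (N : ℝ) ^ 3) *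
                LeTCC.roughness (f ∘ uenc) +
              2 / (K : ℝ) * ∑ k, (f (uenc (α k)) - f (x k)) ^ 2 ∧
        LeTCC.avgError f α x (udec (LeTCC.nonStragglers straggler s)) ≤
            C * ((Real.logb (1 / p) (q * N) + Real.sqrt (1 / δ)) ^ 3 / (N : ℝ) ^ 3) *
                LeTCC.roughness (f ∘ uenc) +
              2 * (ν : ℝ) ^ 2 / (K : ℝ) * ∑ k, (uenc (α k) - x k) ^ 2} := by

  have hp1 : p < 1 := by linarith
  have hq1 : q < 1 := by linarith
  have hl : 0 < Real.log (1 / p) := Real.log_pos (by rw [lt_div_iff₀ hp]; linarith)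
  have hlq : 0 < Real.log (1 / q) := Real.log_pos (by rw [lt_div_iff₀ hq]; linarith)
  obtain ⟨A, hA⟩ : ∃ A, A = 2 + (Real.log (1 / q) + 2) / Real.log (1 / p) := ⟨_, rfl⟩
  have hA0 : 0 < A := by rw [hA]; positivity
  -- With `T` the logarithm plus `√(1/δ)`, `m ≤ A * T` and `Δ_max ≤ 4B/N` give `L ≤ 4AB * T/N`; the
  -- outer 2 comes from `(a + b)² ≤ 2a² + 2b²`. The threshold `1 / (12AB)` below is what `3L < 1`
  -- requires.
  refine ⟨2 * (40 + 576 * (4 * A * B) ^ 3), by positivity, fun δ hδ hδ1 => ?_⟩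
  have hev : ∀ᶠ N : ℕ in Filter.atTop, 2 ≤ N ∧ 1 ≤ q * (N : ℝ) ∧
      (Real.logb (1 / p) (q * N) + Real.sqrt (1 / δ)) / N < 1 / (12 * A * B) := by
    refine (Filter.eventually_ge_atTop 2).and (Filter.Eventually.and ?_ ?_)
    · exact (tendsto_natCast_atTop_atTop.const_mul_atTop hq).eventually_ge_atTop 1
    · exact (LeTCC.tendsto_logb_add_const_div (1 / p) q _ hq).eventually_lt_const (by positivity)
  obtain ⟨n₀, hn₀⟩ := Filter.eventually_atTop.1 hev
  refine ⟨n₀, fun N hN f ν η hf hfd hfdd _ hη K x α hK _ hα uenc huenc β hmono hβ hgap lam hlam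
    hlam4 udec hudec S _ P _ straggler hmeas hind hP => ?_⟩
  obtain ⟨hN2, hqN, hsmall⟩ := hn₀ N hN.le
  obtain ⟨m, hm, hmδ, hmle⟩ := LeTCC.exists_window_length hp hp1 hq hq1 hδ hδ1 hN2 hqN
  rw [← hA] at hmle
  have hN0 : 0 < N := by omega
  have hNR : (0 : ℝ) < N := by exact_mod_cast hN0
  have hT1 : 1 ≤ Real.logb (1 / p) (q * N) + Real.sqrt (1 / δ) := by
    have h1 : 0 ≤ Real.logb (1 / p) (q * N) :=
      Real.logb_nonneg (by rw [lt_div_iff₀ hp]; linarith) hqN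
    have h2 : 1 ≤ Real.sqrt (1 / δ) := by
      rw [Real.one_le_sqrt, le_div_iff₀ hδ]
      linarith
    linarith
  generalize Real.logb (1 / p) (q * N) + Real.sqrt (1 / δ) = T at *
  have hT0 : 0 < T := by linarith
  have hh : LeTCC.MemH2 (f ∘ uenc) := huenc.comp hf hfd hfdd hη
  have hR := LeTCC.roughness_nonneg (f ∘ uenc)
  have hg0 := LeTCC.gapMax_pos hN0 hβ
  have hg := LeTCC.gapMax_le hB hN2 hmono hβ hgap
  have hL : m * LeTCC.gapMax β ≤ 4 * A * B * (T / N) := by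
    calc m * LeTCC.gapMax β ≤ (A * T) * (4 * B / N) :=
          mul_le_mul hmle hg hg0.le (by positivity)
      _ = _ := by ring
  have hLsmall : 3 * (m * LeTCC.gapMax β) < 1 := by
    rw [lt_div_iff₀ (by positivity)] at hsmall
    nlinarith
  have hL3 : (m * LeTCC.gapMax β) ^ 3 ≤ (4 * A * B) ^ 3 * (T ^ 3 / N ^ 3) := by
    rw [← div_pow, ← mul_pow]
    exact pow_le_pow_left₀ (by positivity) hL 3
  have hlam3 : N * lam ≤ T ^ 3 / N ^ 3 := by
    calc N * lam ≤ N * (1 / (N : ℝ) ^ 4) := mul_le_mul_of_nonneg_left hlam4 hNR.le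
      _ = 1 / N ^ 3 := by field_simp
      _ ≤ T ^ 3 / N ^ 3 := div_le_div_of_nonneg_right (one_le_pow₀ hT1) (by positivity)
  refine (ENNReal.ofReal_le_ofReal (by linarith)).trans
    ((LeTCC.measure_windows_ge hmeas hind hp.le hP hm).trans (measure_mono fun s hs => ?_))
  -- If `m > N`, the `N + 1` gaps covering length 2 would force `m * Δ_max ≥ 2`. So a full window
  -- exists, and it makes the surviving set nonempty.
  have hmN : m ≤ N := by
    by_contra hcon
    have h1 : (N : ℝ) ≤ m := by exact_mod_cast (not_le.1 hcon).le
    have h2 := LeTCC.node_add_le hN0 hβ 0 (N + 1)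
    rw [LeTCC.node_eq_one β (by omega)] at h2
    simp only [LeTCC.node] at h2
    have h3 : ((N + 1 : ℕ) : ℝ) ≤ m := by exact_mod_cast not_le.1 hcon
    nlinarith
  obtain ⟨v, hv, -⟩ := hs 0 (by omega)
  have hspl := hudec _ ⟨v, hv⟩
  have hmain : LeTCC.avgError f α x (udec (LeTCC.nonStragglers straggler s)) ≤
      2 * (40 + 576 * (4 * A * B) ^ 3) * (T ^ 3 / (N : ℝ) ^ 3) * LeTCC.roughness (f ∘ uenc) +
        2 / (K : ℝ) * ∑ k, (f (uenc (α k)) - f (x k)) ^ 2 := by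
    refine (LeTCC.avgError_le (h := f ∘ uenc) hK fun k =>
      LeTCC.IsSmoothingSpline.sq_sub_le_of_windows (h := f ∘ uenc) hN0 hmono hβ hm hs hLsmall hlam
        hspl hh (hα k)).trans (add_le_add ?_ le_rfl)
    have h1 := mul_le_mul_of_nonneg_right hlam3 hR
    have h2 := mul_le_mul_of_nonneg_right hL3 hR
    linarith
  exact ⟨hmain, hmain.trans (add_le_add le_rfl (LeTCC.sum_sq_lipschitz_le hf _ _))⟩
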